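/- Let $T>0$, and let $f,g\colon\mathbb{R}\to\mathbb{R}$ be $C^\infty$ and $T$-periodic, with $\frac1T\int_0^T g(t)\,dt=0$. Then there exists $\lambda_0\in\mathbb{R}$ such that for every $\lambda\in\mathbb{N}$ with $\lambda\geqslant\lambda_0$ the equation $$\ddot x=f(t)\sin x-\bigl(1+g(\lambda t)\bigr)\cos x$$ has a $C^\infty$ solution $x\colon\mathbb{R}\to\mathbb{R}$ that is $T$-periodic and satisfies $x(t)\in(0,\pi)$ for all $t\in\mathbb{R}$. -/

import Mathlib

open scoped ContDiff

/-- The mean value `(1 / T) ∫₀ᵀ u(t) dt` of a `T`-periodic function. -/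
noncomputable def meanValue (T : ℝ) (u : ℝ → ℝ) : ℝ :=
  (1 / T) * ∫ t in (0 : ℝ)..T, u t

/-- `x` is a (smooth, globally defined) solution of the pendulum equation
`x'' = f(t) sin x - (1 + g(lam t)) cos x`. -/
def IsPendulumSolution (f g : ℝ → ℝ) (lam : ℝ) (x : ℝ → ℝ) : Prop :=
  ContDiff ℝ ∞ x ∧
    ∀ t : ℝ, deriv (deriv x) t =
      f t * Real.sin (x t) - (1 + g (lam * t)) * Real.cos (x t)

/-!
Write `F t x = f t * sin x - (1 + g (λ t)) * cos x`. The periodic problem `x'' = F t x` is solved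
by the method of ordered lower and upper solutions: if `a ≤ b` are `T`-periodic with `F t a ≤ a''`
and `b'' ≤ F t b`, there is a `T`-periodic solution between them.

Since `g` has mean zero, it has a `T`-periodic second primitive `G`. For a small constant `δ`, the
function `a t = δ / 2 - G (λ t) / λ ^ 2` is a lower solution for large `λ`: its second derivative
is exactly `-g (λ t)`, which cancels the oscillating part of `F` near `x = 0`, while its values lie
in `(0, δ]`, where what is left of `F` is close to `-1` (`pendulum_force_le`). By the symmetry
`x ↦ π - x`, `f ↦ -f`, the function `π - a` is an upper solution. A solution between the two
takes its values in `(0, π)`.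

The solution between `a` and `b` (`exists_periodic_solution_between`) comes from monotone
iteration: if `x ↦ k ^ 2 * x - F t x` is increasing, the map `u ↦ periodicGreen (k ^ 2 * u - F t u)`
is increasing, where `periodicGreen h` is the periodic solution of `u'' = k ^ 2 * u - h`, and it
sends `a` above `a` and `b` below `b` by the maximum principle
(`nonneg_of_periodic_of_second_deriv_le`). Its iterates from `a` increase to a fixed point.
-/

open Set Filter Topology MeasureTheory

/-! ### Periodic primitives -/

lemma Function.Periodic.exists_periodic_primitive {T : ℝ} {h : ℝ → ℝ} (hh : Continuous h)
    (hhT : Function.Periodic h T) (h0 : ∫ t in (0 : ℝ)..T, h t = 0) :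
    ∃ H : ℝ → ℝ, Function.Periodic H T ∧ ∀ t, HasDerivAt H (h t) t := by
  refine ⟨fun t => ∫ s in (0 : ℝ)..t, h s, fun t => ?_, fun t =>
    intervalIntegral.integral_hasDerivAt_right (hh.intervalIntegrable _ _)
      hh.stronglyMeasurable.stronglyMeasurableAtFilter hh.continuousAt⟩
  have h1 := intervalIntegral.integral_add_adjacent_intervals
    (hh.intervalIntegrable (μ := volume) 0 t) (hh.intervalIntegrable (μ := volume) t (t + T))
  have h2 := hhT.intervalIntegral_add_eq t 0
  rw [zero_add, h0] at h2
  simp only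
  rw [← h1, h2, add_zero]

lemma Function.Periodic.exists_periodic_second_primitive {T : ℝ} (hT : 0 < T) {h : ℝ → ℝ}
    (hh : Continuous h) (hhT : Function.Periodic h T) (h0 : ∫ t in (0 : ℝ)..T, h t = 0) :
    ∃ H H' : ℝ → ℝ, Function.Periodic H T ∧ (∀ t, HasDerivAt H (H' t) t) ∧
      ∀ t, HasDerivAt H' (h t) t := by
  obtain ⟨H₁, hp, hd⟩ := hhT.exists_periodic_primitive hh h0
  have hc : Continuous H₁ := continuous_iff_continuousAt.2 fun t => (hd t).continuousAt
  set m := (∫ t in (0 : ℝ)..T, H₁ t) / T with hm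
  obtain ⟨H, hHp, hHd⟩ := Function.Periodic.exists_periodic_primitive (T := T)
    (h := fun t => H₁ t - m) (hc.sub continuous_const) (fun t => by simp [hp t]) (by
      rw [intervalIntegral.integral_sub (hc.intervalIntegrable _ _) (by simp)]
      simp [hm]; field_simp; simp)
  exact ⟨H, _, hHp, hHd, fun t => (hd t).sub_const m⟩

/-! ### The periodic resolvent of the derivative -/

/-- For a `T`-periodic `h` and `k ≠ 0`, the `T`-periodic solution `y` of `y' = k * y - h`. Both
signs of `k` are allowed. -/
noncomputable def periodicResolvent (T k : ℝ) (h : ℝ → ℝ) (t : ℝ) : ℝ :=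
  (1 - Real.exp (-(k * T)))⁻¹ * (Real.exp (k * t) * ∫ s in t..t + T, Real.exp (-(k * s)) * h s)

section Resolvent

variable {T k : ℝ} {h : ℝ → ℝ}

lemma intervalIntegrable_exp_mul (hh : ∀ a b, IntervalIntegrable h volume a b) (a b : ℝ) :
    IntervalIntegrable (fun s => Real.exp (-(k * s)) * h s) volume a b :=
  (hh a b).continuousOn_mul (by fun_prop)

lemma periodicResolvent_eq_primitive_sub (hh : ∀ a b, IntervalIntegrable h volume a b) :
    periodicResolvent T k h = fun t => (1 - Real.exp (-(k * T)))⁻¹ * (Real.exp (k * t) *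
      ((∫ s in (0 : ℝ)..t + T, Real.exp (-(k * s)) * h s) -
        ∫ s in (0 : ℝ)..t, Real.exp (-(k * s)) * h s)) := by
  funext t
  rw [intervalIntegral.integral_interval_sub_left (intervalIntegrable_exp_mul hh _ _)
    (intervalIntegrable_exp_mul hh _ _), periodicResolvent]

lemma continuous_periodicResolvent (hh : ∀ a b, IntervalIntegrable h volume a b) :
    Continuous (periodicResolvent T k h) := by
  have := intervalIntegral.continuous_primitive (intervalIntegrable_exp_mul (k := k) hh) 0
  rw [periodicResolvent_eq_primitive_sub hh]
  fun_prop

lemma one_sub_exp_ne_zero (hT : 0 < T) (hk : k ≠ 0) : 1 - Real.exp (-(k * T)) ≠ 0 := by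
  rw [sub_ne_zero, ne_comm, Ne, Real.exp_eq_one_iff, neg_eq_zero]
  exact mul_ne_zero hk hT.ne'

lemma hasDerivAt_periodicResolvent (hT : 0 < T) (hk : k ≠ 0) (hh : Continuous h)
    (hhT : Function.Periodic h T) (t : ℝ) :
    HasDerivAt (periodicResolvent T k h) (k * periodicResolvent T k h t - h t) t := by
  have hi : ∀ a b, IntervalIntegrable h volume a b := fun a b => hh.intervalIntegrable a b
  have hc : Continuous fun s => Real.exp (-(k * s)) * h s := by fun_prop
  have hp : ∀ t, HasDerivAt (fun t => ∫ s in (0 : ℝ)..t, Real.exp (-(k * s)) * h s)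
      (Real.exp (-(k * t)) * h t) t := fun t =>
    intervalIntegral.integral_hasDerivAt_right (hc.intervalIntegrable _ _)
      hc.stronglyMeasurable.stronglyMeasurableAtFilter hc.continuousAt
  have he : HasDerivAt (fun t => Real.exp (k * t)) (Real.exp (k * t) * k) t := by
    simpa using ((hasDerivAt_id t).const_mul k).exp
  have hd := ((he.mul (((hp (t + T)).comp_add_const t T).sub (hp t))).const_mul
    (1 - Real.exp (-(k * T)))⁻¹)
  rw [periodicResolvent_eq_primitive_sub hi]
  refine hd.congr_deriv ?_
  have hne := one_sub_exp_ne_zero hT hk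
  have e1 : Real.exp (k * t) * Real.exp (-(k * (t + T))) = Real.exp (-(k * T)) := by
    rw [← Real.exp_add]; ring_nf
  have e2 : Real.exp (k * t) * Real.exp (-(k * t)) = 1 := by
    rw [← Real.exp_add]; simp
  have e3 : (1 - Real.exp (-(k * T)))⁻¹ * (1 - Real.exp (-(k * T))) = 1 := inv_mul_cancel₀ hne
  simp only [Pi.sub_apply, hhT t]
  linear_combination (1 - Real.exp (-(k * T)))⁻¹ * h t * (e1 - e2) - h t * e3

lemma periodic_periodicResolvent (hhT : Function.Periodic h T) :
    Function.Periodic (periodicResolvent T k h) T := by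
  intro t
  have : ∫ s in t + T..t + T + T, Real.exp (-(k * s)) * h s =
      Real.exp (-(k * T)) * ∫ s in t..t + T, Real.exp (-(k * s)) * h s := by
    rw [← intervalIntegral.integral_comp_add_right, ← intervalIntegral.integral_const_mul]
    refine intervalIntegral.integral_congr fun s _ => ?_
    rw [hhT s, ← mul_assoc, ← Real.exp_add]
    ring_nf
  rw [periodicResolvent, this, ← mul_assoc (Real.exp _), ← Real.exp_add, periodicResolvent]
  ring_nf

/-- Dominated convergence. The limit `h₀` need not be continuous. -/
lemma tendsto_periodicResolvent {h : ℕ → ℝ → ℝ} {h₀ B : ℝ → ℝ}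
    (hm : ∀ n, Continuous (h n)) (hB : Continuous B) (hb : ∀ n t, |h n t| ≤ B t)
    (hl : ∀ t, Tendsto (fun n => h n t) atTop (𝓝 (h₀ t))) (t : ℝ) :
    Tendsto (fun n => periodicResolvent T k (h n) t) atTop (𝓝 (periodicResolvent T k h₀ t)) := by
  refine Tendsto.const_mul _ (Tendsto.const_mul _ ?_)
  refine intervalIntegral.tendsto_integral_filter_of_dominated_convergence
    (fun s => Real.exp (-(k * s)) * B s) (Eventually.of_forall fun n => ?_)
    (Eventually.of_forall fun n => Eventually.of_forall fun s _ => ?_) ?_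
    (Eventually.of_forall fun s _ => (hl s).const_mul _)
  · have := hm n
    exact Continuous.aestronglyMeasurable (by fun_prop)
  · rw [Real.norm_eq_abs, abs_mul, Real.abs_exp]
    gcongr
    exact hb n s
  · exact Continuous.intervalIntegrable (by fun_prop) _ _

lemma exp_mul_integral_mono (hT : 0 < T) {h₁ h₂ : ℝ → ℝ} (hh₁ : Continuous h₁)
    (hh₂ : Continuous h₂) (hle : ∀ t, h₁ t ≤ h₂ t) (t : ℝ) :
    Real.exp (k * t) * ∫ s in t..t + T, Real.exp (-(k * s)) * h₁ s ≤
      Real.exp (k * t) * ∫ s in t..t + T, Real.exp (-(k * s)) * h₂ s := by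
  gcongr
  refine intervalIntegral.integral_mono_on (by linarith) ?_ ?_ fun s _ => ?_
  · exact Continuous.intervalIntegrable (by fun_prop) _ _
  · exact Continuous.intervalIntegrable (by fun_prop) _ _
  · gcongr
    exact hle s

end Resolvent

/-! ### The periodic Green operator -/

/-- For a `T`-periodic `h` and `k > 0`, the `T`-periodic solution `u` of `u'' = k ^ 2 * u - h`. It is
built from the factorization of `D ^ 2 - k ^ 2` as `(D - k) * (D + k)` by partial fractions. -/
noncomputable def periodicGreen (T k : ℝ) (h : ℝ → ℝ) (t : ℝ) : ℝ :=
  (2 * k)⁻¹ * (periodicResolvent T k h t - periodicResolvent T (-k) h t)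

section Green

variable {T k : ℝ} {h : ℝ → ℝ}

lemma continuous_periodicGreen (hh : ∀ a b, IntervalIntegrable h volume a b) :
    Continuous (periodicGreen T k h) :=
  continuous_const.mul
    ((continuous_periodicResolvent hh).sub (continuous_periodicResolvent hh))

lemma periodic_periodicGreen (hhT : Function.Periodic h T) :
    Function.Periodic (periodicGreen T k h) T := fun t => by
  simp only [periodicGreen, periodic_periodicResolvent hhT t]

/-- `v` is the derivative of `u = periodicGreen T k h`, and `u'' = k ^ 2 * u - h`. -/
lemma hasDerivAt_periodicGreen (hT : 0 < T) (hk : 0 < k) (hh : Continuous h)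
    (hhT : Function.Periodic h T) :
    ∃ v : ℝ → ℝ, (∀ t, HasDerivAt (periodicGreen T k h) (v t) t) ∧
      ∀ t, HasDerivAt v (k ^ 2 * periodicGreen T k h t - h t) t := by
  have hp := hasDerivAt_periodicResolvent hT hk.ne' hh hhT
  have hm := hasDerivAt_periodicResolvent hT (neg_ne_zero.2 hk.ne') hh hhT
  refine ⟨fun t => (periodicResolvent T k h t + periodicResolvent T (-k) h t) / 2,
    fun t => (((hp t).sub (hm t)).const_mul _).congr_deriv ?_,
    fun t => (((hp t).add (hm t)).div_const 2).congr_deriv ?_⟩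
  · field_simp
    ring
  · rw [periodicGreen]
    field_simp
    ring

lemma tendsto_periodicGreen {h : ℕ → ℝ → ℝ} {h₀ B : ℝ → ℝ}
    (hm : ∀ n, Continuous (h n)) (hB : Continuous B) (hb : ∀ n t, |h n t| ≤ B t)
    (hl : ∀ t, Tendsto (fun n => h n t) atTop (𝓝 (h₀ t))) (t : ℝ) :
    Tendsto (fun n => periodicGreen T k (h n) t) atTop (𝓝 (periodicGreen T k h₀ t)) :=
  ((tendsto_periodicResolvent hm hB hb hl t).sub
    (tendsto_periodicResolvent hm hB hb hl t)).const_mul _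

lemma periodicGreen_mono (hT : 0 < T) (hk : 0 < k) {h₁ h₂ : ℝ → ℝ} (hh₁ : Continuous h₁)
    (hh₂ : Continuous h₂) (hle : ∀ t, h₁ t ≤ h₂ t) (t : ℝ) :
    periodicGreen T k h₁ t ≤ periodicGreen T k h₂ t := by
  have hkT : 0 < k * T := mul_pos hk hT
  -- The resolvent at `k` is increasing and the one at `-k` decreasing, by the sign of the factor.
  have c1 : 0 ≤ (1 - Real.exp (-(k * T)))⁻¹ :=
    inv_nonneg.2 (sub_nonneg.2 (Real.exp_le_one_iff.2 (by linarith)))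
  have c2 : (1 - Real.exp (-(-k * T)))⁻¹ ≤ 0 :=
    inv_nonpos.2 (sub_nonpos.2 (Real.one_le_exp (by linarith)))
  have h1 := mul_le_mul_of_nonneg_left (exp_mul_integral_mono (k := k) hT hh₁ hh₂ hle t) c1
  have h2 := mul_le_mul_of_nonpos_left (exp_mul_integral_mono (k := -k) hT hh₁ hh₂ hle t) c2
  exact mul_le_mul_of_nonneg_left (sub_le_sub h1 h2) (by positivity)

end Green

/-! ### Lower and upper solutions -/

/-- The maximum principle for `w'' - k ^ 2 * w` on periodic functions: at a negative minimum the
second derivative would be negative. -/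
lemma nonneg_of_periodic_of_second_deriv_le {T k : ℝ} (hT : 0 < T) (hk : 0 < k)
    {w w' w'' : ℝ → ℝ} (hwT : Function.Periodic w T) (hw : ∀ t, HasDerivAt w (w' t) t)
    (hw' : ∀ t, HasDerivAt w' (w'' t) t) (hle : ∀ t, w'' t ≤ k ^ 2 * w t) (t : ℝ) :
    0 ≤ w t := by
  have hc : Continuous w := continuous_iff_continuousAt.2 fun t => (hw t).continuousAt
  obtain ⟨_, ⟨t₀, rfl⟩, hmin⟩ :=
    (hwT.compact_of_continuous hT.ne' hc).exists_isLeast (range_nonempty w)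
  have hmin : ∀ s, w t₀ ≤ w s := fun s => hmin (mem_range_self s)
  by_contra! hneg
  have hneg₀ : w'' t₀ < 0 :=
    (hle t₀).trans_lt (mul_neg_of_pos_of_neg (by positivity) ((hmin t).trans_lt hneg))
  have hd : deriv w = w' := funext fun s => (hw s).deriv
  have hloc : IsLocalMin w t₀ := Eventually.of_forall hmin
  -- The second derivative test makes the global minimum a local maximum, so `w` is locally constant.
  have hmax : IsLocalMax w t₀ := isLocalMax_of_deriv_deriv_neg
    (by rw [hd, (hw' t₀).deriv]; exact hneg₀) hloc.deriv_eq_zero hc.continuousAt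
  have hconst : w =ᶠ[𝓝 t₀] fun _ => w t₀ := hmax.mono fun s hs => le_antisymm hs (hmin s)
  have hzero := hconst.deriv.deriv_eq
  rw [hd, (hw' t₀).deriv] at hzero
  simp at hzero
  exact hneg₀.ne hzero

/-- The method of ordered lower and upper solutions for the periodic problem `u'' = F t u`: between a
lower solution `a` and an upper solution `b` with `a ≤ b` there is a periodic solution `u`, with
derivative `v`. -/
theorem exists_periodic_solution_between {T k : ℝ} (hT : 0 < T) (hk : 0 < k) {F : ℝ → ℝ → ℝ}
    (hF : Continuous (Function.uncurry F)) (hFT : ∀ t x, F (t + T) x = F t x)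
    (hmono : ∀ t, Monotone fun x => k ^ 2 * x - F t x)
    {a a' a'' b b' b'' : ℝ → ℝ} (haT : Function.Periodic a T) (hbT : Function.Periodic b T)
    (ha : ∀ t, HasDerivAt a (a' t) t) (ha' : ∀ t, HasDerivAt a' (a'' t) t)
    (hb : ∀ t, HasDerivAt b (b' t) t) (hb' : ∀ t, HasDerivAt b' (b'' t) t)
    (hab : ∀ t, a t ≤ b t) (haF : ∀ t, F t (a t) ≤ a'' t) (hbF : ∀ t, b'' t ≤ F t (b t)) :
    ∃ u v : ℝ → ℝ, Function.Periodic u T ∧ (∀ t, HasDerivAt u (v t) t) ∧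
      (∀ t, HasDerivAt v (F t (u t)) t) ∧ ∀ t, u t ∈ Icc (a t) (b t) := by
  set N : (ℝ → ℝ) → ℝ → ℝ := fun u t => k ^ 2 * u t - F t (u t) with hN
  set Φ : (ℝ → ℝ) → ℝ → ℝ := fun u => periodicGreen T k (N u) with hΦ
  have hac : Continuous a := continuous_iff_continuousAt.2 fun t => (ha t).continuousAt
  have hbc : Continuous b := continuous_iff_continuousAt.2 fun t => (hb t).continuousAt
  have hNc : ∀ {u}, Continuous u → Continuous (N u) := fun {u} hu =>
    (hu.const_mul _).sub (hF.comp (continuous_id.prodMk hu))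
  have hNT : ∀ {u}, Function.Periodic u T → Function.Periodic (N u) T := fun {u} hu t => by
    simp only [hN, hu t, hFT]
  have hΦc : ∀ {u}, Continuous u → Continuous (Φ u) := fun hu =>
    continuous_periodicGreen fun x y => (hNc hu).intervalIntegrable x y
  have hΦT : ∀ {u}, Function.Periodic u T → Function.Periodic (Φ u) T := fun hu =>
    periodic_periodicGreen (hNT hu)
  have hΦm : ∀ {u v}, Continuous u → Continuous v → (∀ t, u t ≤ v t) → ∀ t, Φ u t ≤ Φ v t :=
    fun hu hv huv => periodicGreen_mono hT hk (hNc hu) (hNc hv) fun t => hmono t (huv t)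
  have haΦ : ∀ t, a t ≤ Φ a t := by
    obtain ⟨v, hv, hv'⟩ := hasDerivAt_periodicGreen hT hk (hNc hac) (hNT haT)
    intro t
    refine sub_nonneg.1 (nonneg_of_periodic_of_second_deriv_le hT hk (w := fun t => Φ a t - a t)
      ((hΦT haT).sub haT) (fun t => (hv t).sub (ha t)) (fun t => (hv' t).sub (ha' t))
      (fun t => ?_) t)
    simp only [hΦ, hN]
    linarith [haF t]
  have hbΦ : ∀ t, Φ b t ≤ b t := by
    obtain ⟨v, hv, hv'⟩ := hasDerivAt_periodicGreen hT hk (hNc hbc) (hNT hbT)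
    intro t
    refine sub_nonneg.1 (nonneg_of_periodic_of_second_deriv_le hT hk (w := fun t => b t - Φ b t)
      (hbT.sub (hΦT hbT)) (fun t => (hb t).sub (hv t)) (fun t => (hb' t).sub (hv' t))
      (fun t => ?_) t)
    simp only [hΦ, hN]
    linarith [hbF t]
  set U : ℕ → ℝ → ℝ := fun n => Φ^[n] a with hU
  have hUs : ∀ n, U (n + 1) = Φ (U n) := fun n => Function.iterate_succ_apply' Φ n a
  have hUc : ∀ n, Continuous (U n) := fun n => by
    induction n with
    | zero => exact hac
    | succ n ih => rw [hUs]; exact hΦc ih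
  have hUT : ∀ n, Function.Periodic (U n) T := fun n => by
    induction n with
    | zero => exact haT
    | succ n ih => rw [hUs]; exact hΦT ih
  have hUle : ∀ n t, U n t ≤ U (n + 1) t := fun n => by
    induction n with
    | zero => exact haΦ
    | succ n ih =>
      intro t
      rw [hUs n, hUs (n + 1)]
      exact hΦm (hUc n) (hUc (n + 1)) ih t
  have hUb : ∀ n t, U n t ≤ b t := fun n => by
    induction n with
    | zero => exact hab
    | succ n ih =>
      intro t
      rw [hUs n]
      exact (hΦm (hUc n) hbc ih t).trans (hbΦ t)
  have hUm : ∀ t, Monotone fun n => U n t := fun t => monotone_nat_of_le_succ fun n => hUle n t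
  have hUa : ∀ n t, a t ≤ U n t := fun n t => hUm t (Nat.zero_le n)
  set u : ℝ → ℝ := fun t => ⨆ n, U n t with hu
  have hlim : ∀ t, Tendsto (fun n => U n t) atTop (𝓝 (u t)) := fun t =>
    tendsto_atTop_ciSup (hUm t) ⟨b t, by rintro _ ⟨n, rfl⟩; exact hUb n t⟩
  have hua : ∀ t, a t ≤ u t := fun t => ge_of_tendsto' (hlim t) fun n => hUa n t
  have hub : ∀ t, u t ≤ b t := fun t => le_of_tendsto' (hlim t) fun n => hUb n t
  have huT : Function.Periodic u T := fun t => by simp only [hu, hUT _ t]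
  have hbound : ∀ {y : ℝ → ℝ} {t}, a t ≤ y t → y t ≤ b t → |N y t| ≤ |N a t| + |N b t| := by
    intro y t h1 h2
    have l1 : N a t ≤ N y t := hmono t h1
    have l2 : N y t ≤ N b t := hmono t h2
    refine abs_le.2 ⟨?_, ?_⟩
    · linarith [neg_abs_le (N a t), abs_nonneg (N b t)]
    · linarith [le_abs_self (N b t), abs_nonneg (N a t)]
  have hBc : Continuous fun t => |N a t| + |N b t| := (hNc hac).abs.add (hNc hbc).abs
  have hNlim : ∀ t, Tendsto (fun n => N (U n) t) atTop (𝓝 (N u t)) := fun t =>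
    ((hlim t).const_mul _).sub
      ((hF.comp (Continuous.prodMk_right t)).continuousAt.tendsto.comp (hlim t))
  have hfix : u = Φ u := by
    funext t
    refine tendsto_nhds_unique ((hlim t).comp (tendsto_add_atTop_nat 1)) ?_
    have := tendsto_periodicGreen (T := T) (k := k) (fun n => hNc (hUc n)) hBc
      (fun n t => hbound (hUa n t) (hUb n t)) hNlim t
    refine this.congr fun n => ?_
    simp only [Function.comp, hUs n, hΦ]
  have hNmeas : Measurable (N u) :=
    measurable_of_tendsto_metrizable (fun n => (hNc (hUc n)).measurable) (tendsto_pi_nhds.2 hNlim)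
  -- So far `u` is only a pointwise limit; being the Green operator of a measurable, locally bounded
  -- function makes it continuous.
  have huc : Continuous u := by
    rw [hfix]
    refine continuous_periodicGreen fun x y => ?_
    refine (hBc.intervalIntegrable x y).mono_fun hNmeas.aestronglyMeasurable
      (Eventually.of_forall fun t => ?_)
    exact (hbound (hua t) (hub t)).trans (le_abs_self _)
  obtain ⟨v, hv, hv'⟩ := hasDerivAt_periodicGreen hT hk (hNc huc) (hNT huT)
  refine ⟨u, v, huT, fun t => ?_, fun t => (hv' t).congr_deriv ?_, fun t => ⟨hua t, hub t⟩⟩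
  · rw [hfix]
    exact hv t
  · have : periodicGreen T k (N u) t = u t := (congrFun hfix t).symm
    rw [this]
    simp only [hN]
    ring

/-- Bootstrapping: a solution of `u'' = F t u` with smooth `F` is smooth. -/
lemma contDiff_infty_of_second_deriv {u v : ℝ → ℝ} {F : ℝ → ℝ → ℝ}
    (hF : ContDiff ℝ ∞ (Function.uncurry F)) (hu : ∀ t, HasDerivAt u (v t) t)
    (hv : ∀ t, HasDerivAt v (F t (u t)) t) : ContDiff ℝ ∞ u := by
  have key : ∀ n : ℕ, ContDiff ℝ n u ∧ ContDiff ℝ n v := by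
    have hdu : deriv u = v := funext fun t => (hu t).deriv
    have hdv : deriv v = fun t => F t (u t) := funext fun t => (hv t).deriv
    intro n
    induction n with
    | zero =>
      exact ⟨contDiff_zero.2 (continuous_iff_continuousAt.2 fun t => (hu t).continuousAt),
        contDiff_zero.2 (continuous_iff_continuousAt.2 fun t => (hv t).continuousAt)⟩
    | succ n ih =>
      push_cast
      rw [contDiff_succ_iff_deriv, contDiff_succ_iff_deriv, hdu, hdv]
      refine ⟨⟨fun t => (hu t).differentiableAt, by simp, ih.2⟩,
        fun t => (hv t).differentiableAt, by simp, ?_⟩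
      exact (hF.of_le (by exact_mod_cast le_top)).comp (contDiff_id.prodMk ih.1)
  exact contDiff_infty.2 fun n => (key n).1

/-! ### The pendulum -/

/-- Near `x = 0` the force is at most its oscillating part: the rest,
`p * sin x - cos x + q * (1 - cos x)`, is close to `-1`. -/
lemma pendulum_force_le {A B p q x : ℝ} (hp : |p| ≤ A) (hq : |q| ≤ B) (hx : 0 < x)
    (hxs : x ≤ 1 / (1 + A + B)) : p * Real.sin x - (1 + q) * Real.cos x ≤ -q := by
  have hA := (abs_nonneg p).trans hp
  have hB := (abs_nonneg q).trans hq
  rw [le_div_iff₀ (by positivity)] at hxs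
  have hx1 : x ≤ 1 := by nlinarith
  have hs : p * Real.sin x ≤ A * x := by
    refine (le_abs_self _).trans ?_
    rw [abs_mul]
    gcongr
    exact (Real.abs_sin_le_abs).trans_eq (abs_of_pos hx)
  -- `1 - cos x ≤ x ^ 2 / 2 ≤ x`; a linear bound is enough.
  have hc : 1 - Real.cos x ≤ x := by nlinarith [Real.one_sub_sq_div_two_le_cos (x := x)]
  have hc0 : 0 ≤ 1 - Real.cos x := sub_nonneg.2 (Real.cos_le_one x)
  have hq' : (1 + q) * (1 - Real.cos x) ≤ (1 + B) * x := by
    have : 1 + q ≤ 1 + B := by linarith [le_abs_self q]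
    exact (mul_le_mul_of_nonneg_right this hc0).trans (by gcongr)
  linarith

/-- The monotonicity needed for the iteration, with a `k` independent of time. -/
lemma pendulum_monotone {A B k p q : ℝ} (hp : |p| ≤ A) (hq : |q| ≤ B) (hk : 1 + A + B ≤ k ^ 2) :
    Monotone fun x => k ^ 2 * x - (p * Real.sin x - (1 + q) * Real.cos x) := by
  have hd : ∀ x, HasDerivAt (fun x => k ^ 2 * x - (p * Real.sin x - (1 + q) * Real.cos x))
      (k ^ 2 * 1 - (p * Real.cos x - (1 + q) * -Real.sin x)) x := fun x =>
    ((hasDerivAt_id x).const_mul _).sub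
      (((Real.hasDerivAt_sin x).const_mul p).sub ((Real.hasDerivAt_cos x).const_mul (1 + q)))
  refine monotone_of_hasDerivAt_nonneg hd fun x => ?_
  have h1 : p * Real.cos x ≤ A := by
    refine (le_abs_self _).trans ?_
    rw [abs_mul]
    exact (mul_le_of_le_one_right (abs_nonneg p) (Real.abs_cos_le_one x)).trans hp
  have h2 : (1 + q) * Real.sin x ≤ 1 + B := by
    refine (le_abs_self _).trans ?_
    rw [abs_mul]
    refine (mul_le_of_le_one_right (abs_nonneg _) (Real.abs_sin_le_one x)).trans ?_
    exact (abs_add_le 1 q).trans (by simpa using hq)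
  simp only [Pi.zero_apply]
  linarith

lemma Function.Periodic.exists_abs_le {T : ℝ} (hT : 0 < T) {h : ℝ → ℝ} (hhT : Function.Periodic h T)
    (hh : Continuous h) : ∃ M, ∀ t, |h t| ≤ M := by
  obtain ⟨M, hM⟩ := (hhT.isBounded_of_continuous hT.ne' hh).exists_norm_le
  exact ⟨M, fun t => hM _ (mem_range_self t)⟩

theorem theorem3p8 (T : ℝ) (hT : 0 < T) (f g : ℝ → ℝ)
    (hf : ContDiff ℝ ∞ f) (hg : ContDiff ℝ ∞ g)
    (hfT : Function.Periodic f T) (hgT : Function.Periodic g T)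
    (hg0 : meanValue T g = 0) :
    ∃ lam₀ : ℝ, ∀ lam : ℕ, lam₀ ≤ (lam : ℝ) →
      ∃ x : ℝ → ℝ, IsPendulumSolution f g (lam : ℝ) x ∧ Function.Periodic x T ∧
        ∀ t : ℝ, x t ∈ Set.Ioo 0 Real.pi := by
  have hint : ∫ t in (0 : ℝ)..T, g t = 0 :=
    (mul_eq_zero.1 hg0).resolve_left (one_div_ne_zero hT.ne')
  obtain ⟨G, G', hGT, hG, hG'⟩ :=
    hgT.exists_periodic_second_primitive hT hg.continuous hint
  obtain ⟨A, hA⟩ := hfT.exists_abs_le hT hf.continuous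
  obtain ⟨B, hB⟩ := hgT.exists_abs_le hT hg.continuous
  obtain ⟨M, hM⟩ := hGT.exists_abs_le hT
    (continuous_iff_continuousAt.2 fun t => (hG t).continuousAt)
  have hA0 := (abs_nonneg _).trans (hA 0)
  have hB0 := (abs_nonneg _).trans (hB 0)
  have hM0 := (abs_nonneg _).trans (hM 0)
  set δ := 1 / (1 + A + B) with hδ
  have hδ0 : 0 < δ := by positivity
  have hδ1 : δ ≤ 1 := by
    rw [hδ, div_le_one (by positivity)]
    linarith
  -- For `λ ≥ 1 + 2 * M / δ` the oscillation `G (λ t) / λ ^ 2` is smaller than `δ / 2`.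
  refine ⟨1 + 2 * M / δ, fun lam hlam => ?_⟩
  set l : ℝ := (lam : ℝ) with hl
  have hl1 : 1 ≤ l := le_trans (by simp; positivity) hlam
  have hl0 : l ≠ 0 := by positivity
  have hsmall : ∀ t, |G (l * t) / l ^ 2| < δ / 2 := fun t => by
    rw [abs_div, abs_of_pos (by positivity : 0 < l ^ 2), div_lt_iff₀ (by positivity)]
    have h1 : 2 * M / δ < l := by linarith
    rw [div_lt_iff₀ hδ0] at h1
    nlinarith [hM (l * t)]
  -- Here `λ` has to be a natural number.
  have hper : ∀ {h : ℝ → ℝ}, Function.Periodic h T → ∀ t, h (l * (t + T)) = h (l * t) :=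
    fun hh t => by rw [mul_add]; exact hh.nat_mul lam (l * t)
  have hlin : ∀ t, HasDerivAt (fun t : ℝ => l * t) l t := fun t => by
    simpa using (hasDerivAt_id t).const_mul l
  set a : ℝ → ℝ := fun t => δ / 2 - G (l * t) / l ^ 2 with ha
  have ha_pos : ∀ t, 0 < a t := fun t => by
    simp only [ha]
    linarith [(abs_lt.1 (hsmall t)).2]
  have ha_le : ∀ t, a t ≤ δ := fun t => by
    simp only [ha]
    linarith [(abs_lt.1 (hsmall t)).1]
  have haT : Function.Periodic a T := fun t => by simp only [ha, hper hGT]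
  have had : ∀ t, HasDerivAt a (-(G' (l * t) / l)) t := fun t =>
    ((((hG (l * t)).comp t (hlin t)).div_const (l ^ 2)).const_sub (δ / 2)).congr_deriv (by
      field_simp)
  have had' : ∀ t, HasDerivAt (fun t => -(G' (l * t) / l)) (-g (l * t)) t := fun t =>
    (((hG' (l * t)).comp t (hlin t)).div_const l).neg.congr_deriv (by field_simp)
  set F : ℝ → ℝ → ℝ := fun t x => f t * Real.sin x - (1 + g (l * t)) * Real.cos x with hF
  have hFs : ContDiff ℝ ∞ (Function.uncurry F) :=
    ((hf.comp contDiff_fst).mul (Real.contDiff_sin.comp contDiff_snd)).sub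
      ((contDiff_const.add (hg.comp (contDiff_const.mul contDiff_fst))).mul
        (Real.contDiff_cos.comp contDiff_snd))
  obtain ⟨u, v, huT, hu, hv, hmem⟩ := exists_periodic_solution_between
    (b := fun t => Real.pi - a t) (b'' := fun t => g (l * t)) hT
    (Real.sqrt_pos.2 (by positivity : 0 < 1 + A + B)) hFs.continuous
    (fun t x => by simp only [hF, hfT t, hper hgT])
    (fun t => pendulum_monotone (hA t) (hB (l * t)) (Real.sq_sqrt (by positivity)).ge)
    haT (fun t => by simp only [haT t]) had had'
    (fun t => (had t).const_sub Real.pi) (fun t => (had' t).neg.congr_deriv (neg_neg _))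
    (fun t => by linarith [ha_le t, Real.pi_gt_three])
    (fun t => pendulum_force_le (hA t) (hB (l * t)) (ha_pos t) (ha_le t))
    (fun t => by
      have := pendulum_force_le (p := -f t) (by rw [abs_neg]; exact hA t) (hB (l * t))
        (ha_pos t) (ha_le t)
      simp only [hF, Real.sin_pi_sub, Real.cos_pi_sub]
      linarith)
  refine ⟨u, ⟨contDiff_infty_of_second_deriv hFs hu hv, fun t => ?_⟩, huT, fun t =>
    ⟨(ha_pos t).trans_le (hmem t).1, (hmem t).2.trans_lt (by linarith [ha_pos t])⟩⟩
  rw [funext fun t => (hu t).deriv, (hv t).deriv]
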